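/- Let $X$ be a metric space, $f:X\to X$, and $Y\subseteq X$. * The $\omega$-limit set of $x\in X$ is $\omega(x,f)=\bigcap_{k\ge 0}\overline{\{f^n(x): n\ge k\}}$. * A closed set $Y$ is *weakly incompressible* if $M\cap\overline{f(Y\setminus M)}\neq\emptyset$ for every nonempty, closed, proper subset $M$ of $Y$. * $Y$ is *internally chain transitive* if for all $a,b\in Y$ and every $\varepsilon>0$ there are $m\ge 1$ and points $x_0=a,x_1,\dots,x_m=b$ of $Y$ with $d(f(x_n),x_{n+1})<\varepsilon$ for all $0\le n<m$. * $f:[0,1]\to[0,1]$ is *piecewise linear* (with finitely many pieces) if there are $0=c_0<c_1<\dots<c_m=1$ such that $f$ is affine on each $[c_{i-1},c_i]$; it is *uniformly piecewise linear* if moreover the modulus of its gradient is greater than $1$ and is the same on all the pieces. A *critical point* of such an $f$ is a point of the open interval $(0,1)$ at which $f$ has a local extremum. * A *shift of finite type* is the shift map $\sigma(x)_n=x_{n+1}$ on the set of all sequences $x\in A^{\mathbb N}$ (one-sided) or $x\in A^{\mathbb Z}$ (two-sided) in which no word of $F$ occurs, where $A$ is a finite alphabet and $F$ is a finite set of finite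 words over $A$; this space carries the topology of pointwise convergence ($A$ being discrete). **Corollary.** Let $\Lambda\subseteq X$ be closed and suppose that one of the following holds: 1. $X=[0,1]$ and $f$ is uniformly piecewise linear and takes the value $0$ or $1$ at each of its local extrema on $[0,1]$, the endpoints $0$ and $1$ included; 2. $X=[0,1]$, $f$ is piecewise linear with finitely many pieces, each of gradient modulus greater than $1$, and $\Lambda$ does not contain the image of any critical point of $f$; 3. $f$ is a one-sided or a two-sided shift of finite type, where $X$ carries any metric inducing its topology (more generally, $X$ is a metric space and $f$ is topologically conjugate to such a shift). Then for every nonempty closed set $Y\subseteq\Lambda$ that is not a singleton $\{y\}$ with $f(y)\neq y$, the following are equivalent: (a) $Y$ is weakly incompressible; (b) $Y$ is internally chain transitive; (c) $Y=\omega(x_Y,f)$ for some $x_Y\in X$. -/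

import Mathlib

open Set Filter Topology unitInterval

section Dynamics

/-- The `ω`-limit set of the point `x` under iteration of `f`. -/
def omegaLimitSet {X : Type*} [TopologicalSpace X] (f : X → X) (x : X) : Set X :=
  omegaLimit atTop (fun (n : ℕ) (y : X) => f^[n] y) {x}

/-- The `ω`-limit set is `⋂ k, closure {f^n x : n ≥ k}`. -/
theorem omegaLimitSet_eq_iInter {X : Type*} [TopologicalSpace X] (f : X → X) (x : X) :
    omegaLimitSet f x = ⋂ k : ℕ, closure {y | ∃ n, k ≤ n ∧ f^[n] x = y} := by
  have key : ∀ u : Set ℕ,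
      image2 (fun (n : ℕ) (y : X) => f^[n] y) u {x} = {y | ∃ n ∈ u, f^[n] x = y} := by
    intro u
    ext y
    simp
  unfold omegaLimitSet
  rw [omegaLimit_def]
  apply Subset.antisymm
  · intro y hy
    rw [mem_iInter]
    intro k
    have h1 := mem_iInter₂.1 hy (Ici k) (Ici_mem_atTop k)
    rw [key] at h1
    exact h1
  · intro y hy
    rw [mem_iInter₂]
    intro u hu
    obtain ⟨k, hk⟩ := mem_atTop_sets.1 hu
    have h1 := mem_iInter.1 hy k
    rw [key]
    refine closure_mono ?_ h1
    rintro z ⟨n, hn, rfl⟩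
    exact ⟨n, hk n hn, rfl⟩

/-- The closed set `Y` is weakly incompressible: `M ∩ closure (f (Y \ M))` is nonempty for every
nonempty, closed, proper subset `M` of `Y`. -/
def WeaklyIncompressible {X : Type*} [TopologicalSpace X] (f : X → X) (Y : Set X) : Prop :=
  ∀ M : Set X, M ⊂ Y → M.Nonempty → IsClosed M → (M ∩ closure (f '' (Y \ M))).Nonempty

/-- `x 0, …, x m` is a finite `ε`-pseudo-orbit of `f` (the values `x n` for `n > m` are
irrelevant). -/
def IsFinitePseudoOrbit {X : Type*} [MetricSpace X] (f : X → X) (ε : ℝ) (m : ℕ) (x : ℕ → X) :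
    Prop :=
  ∀ n < m, dist (f (x n)) (x (n + 1)) < ε

/-- `Y` is internally chain transitive: any two points `a`, `b` of `Y` (possibly equal) are joined,
for each `ε > 0`, by an `ε`-pseudo-orbit `x 0 = a, …, x m = b` with `m > 0` that lies in `Y`. -/
def InternallyChainTransitive {X : Type*} [MetricSpace X] (f : X → X) (Y : Set X) : Prop :=
  ∀ a ∈ Y, ∀ b ∈ Y, ∀ ε > 0, ∃ m > 0, ∃ x : ℕ → X,
    x 0 = a ∧ x m = b ∧ (∀ n ≤ m, x n ∈ Y) ∧ IsFinitePseudoOrbit f ε m x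

end Dynamics

section IntervalMaps

/-- `f` is piecewise linear on `[0,1]` with division points `0 = c 0 < c 1 < ⋯ < c m = 1`, the
gradient on the closed interval from `c i` to `c (i + 1)` being `a i`. -/
def PiecewiseLinearWith (f : I → I) (m : ℕ) (c : Fin (m + 1) → I) (a : Fin m → ℝ) : Prop :=
  c 0 = 0 ∧ c (Fin.last m) = 1 ∧ StrictMono c ∧
    ∀ i : Fin m, ∀ x ∈ Icc (c i.castSucc) (c i.succ), ∀ y ∈ Icc (c i.castSucc) (c i.succ),
      (f y : ℝ) - (f x : ℝ) = a i * ((y : ℝ) - (x : ℝ))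

/-- Piecewise linear, with finitely many pieces, and gradient modulus everywhere greater
than `1`. -/
def ExpandingPiecewiseLinear (f : I → I) : Prop :=
  ∃ (m : ℕ) (c : Fin (m + 1) → I) (a : Fin m → ℝ),
    PiecewiseLinearWith f m c a ∧ ∀ i, 1 < |a i|

/-- Piecewise linear, with gradient modulus greater than `1` and equal on all the pieces. -/
def UniformlyPiecewiseLinear (f : I → I) : Prop :=
  ∃ (m : ℕ) (c : Fin (m + 1) → I) (a : Fin m → ℝ) (s : ℝ),
    PiecewiseLinearWith f m c a ∧ 1 < s ∧ ∀ i, |a i| = s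

/-- A critical (turning) point of a piecewise monotone interval map: an interior point of `[0,1]`
at which the map has a local extremum. -/
def IsCriticalPoint (f : I → I) (x : I) : Prop :=
  0 < x ∧ x < 1 ∧ IsLocalExtr f x

end IntervalMaps

section Shifts

/-- One-sided subshift: the sequences `x : ℕ → A` in which no word of `F` occurs. It is a shift of
finite type when `A` and `F` are finite. -/
def OneSidedShift {A : Type*} (F : Set (List A)) : Set (ℕ → A) :=
  {x | ∀ w ∈ F, ∀ i : ℕ, ¬ ∀ (j : ℕ) (hj : j < w.length), x (i + j) = w[j]}

/-- The shift map of a one-sided subshift. -/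
def oneSidedShiftMap {A : Type*} (F : Set (List A)) (x : OneSidedShift F) : OneSidedShift F :=
  ⟨fun n => x.1 (n + 1), fun w hw i h =>
    x.2 w hw (i + 1) fun j hj => (congrArg x.1 (by omega)).trans (h j hj)⟩

/-- Two-sided subshift: the sequences `x : ℤ → A` in which no word of `F` occurs. It is a shift of
finite type when `A` and `F` are finite. -/
def TwoSidedShift {A : Type*} (F : Set (List A)) : Set (ℤ → A) :=
  {x | ∀ w ∈ F, ∀ i : ℤ, ¬ ∀ (j : ℕ) (hj : j < w.length), x (i + (j : ℤ)) = w[j]}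

/-- The shift map of a two-sided subshift. -/
def twoSidedShiftMap {A : Type*} (F : Set (List A)) (x : TwoSidedShift F) : TwoSidedShift F :=
  ⟨fun n => x.1 (n + 1), fun w hw i h =>
    x.2 w hw (i + 1) fun j hj => (congrArg x.1 (by omega)).trans (h j hj)⟩

end Shifts

/-! ### Weak incompressibility, chain transitivity and limit sets -/

section ChainTransitivity

variable {X : Type*} [MetricSpace X] {f : X → X} {Y : Set X}

/-! For continuous `f` on a compact space, (a) ⇔ (b) and (c) ⇒ (b) are general facts. A closed set
of chain-reachable points cannot be left, or its complement entered, without an arbitrarily small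
gap; and an orbit stays close to its limit set, so its points can be replaced by nearby points of
that set to form chains.

The content is (b) ⇒ (c). Concatenating ever finer chains in `Y` gives an asymptotic pseudo-orbit
visiting each point of a dense sequence infinitely often
(`InternallyChainTransitive.exists_asymptotic_pseudoOrbit`). If a true orbit is asymptotic to a tail
of it, the limit set of that orbit is `Y`. It remains to prove this shadowing property.

For expanding interval maps, a pseudo-orbit is shadowed by pulling back from its end: points near `f
x` have preimages near `x`, closer by a fixed factor (`HasContractingPreimages`). This can fail only
near a local extremum, where values beyond the extreme one are missed; if the extreme value is `0`
or `1` there are none beyond. In case 2, `f` maps `Y` onto `Y`, which forces this condition at the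
extrema in `Y`.

For a shift of finite type, the zeroth symbols of the pseudo-orbit spell the shadowing point: far
enough along, its windows of bounded length all occur in actual points of the shift. -/

theorem mem_omegaLimitSet_iff {x y : X} :
    y ∈ omegaLimitSet f x ↔ ∀ ε > 0, ∀ N : ℕ, ∃ n ≥ N, dist (f^[n] x) y < ε := by
  rw [omegaLimitSet_eq_iInter, mem_iInter]
  simp only [Metric.mem_closure_iff]
  constructor
  · intro h ε hε N
    obtain ⟨_, ⟨n, hn, rfl⟩, hd⟩ := h N ε hε
    exact ⟨n, hn, by rwa [dist_comm]⟩
  · intro h N ε hε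
    obtain ⟨n, hn, hd⟩ := h ε hε N
    exact ⟨_, ⟨n, hn, rfl⟩, by rwa [dist_comm]⟩

theorem InternallyChainTransitive.mapsTo (h : InternallyChainTransitive f Y) (hY : IsClosed Y) :
    MapsTo f Y Y := by
  intro a ha
  rw [← hY.closure_eq, Metric.mem_closure_iff]
  intro ε hε
  obtain ⟨m, hm, x, h0, -, hx, hd⟩ := h a ha a ha ε hε
  exact ⟨x 1, hx 1 hm, by simpa [h0] using hd 0 hm⟩

/-- The last link of a chain ending at `b` puts a point of `f '' Y` within `ε` of `b`, and `f '' Y`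
is closed. -/
theorem InternallyChainTransitive.surjOn (h : InternallyChainTransitive f Y) (hf : Continuous f)
    (hY : IsCompact Y) : SurjOn f Y Y := by
  intro b hb
  rw [← (hY.image hf).isClosed.closure_eq, Metric.mem_closure_iff]
  intro ε hε
  obtain ⟨m, hm, x, -, h1, hx, hd⟩ := h b hb b hb ε hε
  obtain ⟨k, rfl⟩ := Nat.exists_eq_succ_of_ne_zero hm.ne'
  refine ⟨_, mem_image_of_mem f (hx k (by omega)), ?_⟩
  have := hd k (by omega)
  rwa [h1, dist_comm] at this

/-- A chain followed by one more step is a chain. -/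
theorem exists_chain_snoc {ε : ℝ} {a y z : X} (hz : z ∈ Y) (hd : dist (f y) z < ε)
    (hy : ∃ m > 0, ∃ x : ℕ → X,
      x 0 = a ∧ x m = y ∧ (∀ n ≤ m, x n ∈ Y) ∧ IsFinitePseudoOrbit f ε m x) :
    ∃ m > 0, ∃ x : ℕ → X,
      x 0 = a ∧ x m = z ∧ (∀ n ≤ m, x n ∈ Y) ∧ IsFinitePseudoOrbit f ε m x := by
  obtain ⟨m, hm, x, h0, h1, hx, hp⟩ := hy
  refine ⟨m + 1, by omega, Function.update x (m + 1) z, ?_, ?_, ?_, ?_⟩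
  · rw [Function.update_of_ne (by omega), h0]
  · rw [Function.update_self]
  · intro n hn
    rcases eq_or_ne n (m + 1) with rfl | hne
    · rwa [Function.update_self]
    · rw [Function.update_of_ne hne]
      exact hx n (by omega)
  · intro n hn
    rw [Function.update_of_ne (by omega)]
    rcases eq_or_ne n m with rfl | hne
    · rwa [Function.update_self, h1]
    · rw [Function.update_of_ne (by omega)]
      exact hp n (by omega)

/-- The set `R` of points reachable from `a` is relatively open in `Y`. If it were proper,
incompressibility of `Y \ R` would give one more link leading from `R` to a point outside it. -/
theorem WeaklyIncompressible.internallyChainTransitive (h : WeaklyIncompressible f Y)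
    (hf : Continuous f) (hY : IsClosed Y) (hs : ∀ y, Y = {y} → f y = y) :
    InternallyChainTransitive f Y := by
  intro a ha b hb ε hε
  by_cases hsub : Y = {a}
  · obtain rfl : b = a := by rwa [hsub] at hb
    refine ⟨1, one_pos, fun _ => b, rfl, rfl, fun _ _ => ha, fun n _ => ?_⟩
    simpa [hs b hsub] using hε
  obtain ⟨b', hb', hne⟩ : ∃ b' ∈ Y, b' ≠ a := by
    by_contra! hall
    exact hsub (eq_singleton_iff_unique_mem.2 ⟨ha, hall⟩)
  set R : Set X := {z | ∃ m > 0, ∃ x : ℕ → X,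
    x 0 = a ∧ x m = z ∧ (∀ n ≤ m, x n ∈ Y) ∧ IsFinitePseudoOrbit f ε m x} with hR
  have hone : ∀ z ∈ Y, dist (f a) z < ε → z ∈ R := by
    intro z hz hd
    refine ⟨1, one_pos, fun n => if n = 0 then a else z, by simp, by simp, ?_, ?_⟩
    · intro n _
      dsimp only
      split_ifs <;> assumption
    · intro n hn
      obtain rfl : n = 0 := by omega
      simpa using hd
  have hRY : R ⊆ Y := by
    rintro z ⟨m, -, x, -, rfl, hx, -⟩
    exact hx m le_rfl
  -- Invariance of `Y` is not known here, so `f a` need not lie in `Y`. Removing a small ball about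
  -- `a` from `Y` leaves a set `M` that meets the closure of the image of that ball, whence a point
  -- of `Y` near `f a`.
  obtain ⟨z₀, hz₀⟩ : R.Nonempty := by
    obtain ⟨η, hη, hcont⟩ := Metric.continuousAt_iff.1 (hf.continuousAt (x := a)) (ε / 2)
      (half_pos hε)
    set η' := min η (dist b' a)
    have hη' : 0 < η' := lt_min hη (dist_pos.2 hne)
    obtain ⟨z, hz, hzc⟩ := h (Y ∩ (Metric.ball a η')ᶜ)
      ⟨inter_subset_left, fun hsub' => (hsub' ha).2 (Metric.mem_ball_self hη')⟩
      ⟨b', hb', fun hlt => (min_le_right η (dist b' a)).not_gt hlt⟩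
      (hY.inter Metric.isOpen_ball.isClosed_compl)
    obtain ⟨_, ⟨y, hy, rfl⟩, hyz⟩ := Metric.mem_closure_iff.1 hzc (ε / 2) (half_pos hε)
    have hya : dist y a < η' := by
      by_contra hcon
      exact hy.2 ⟨hy.1, hcon⟩
    have := hcont (hya.trans_le (min_le_left _ _))
    refine ⟨z, hone z hz.1 ?_⟩
    calc dist (f a) z ≤ dist (f y) (f a) + dist z (f y) := by
          rw [dist_comm (f y), dist_comm z]; exact dist_triangle _ _ _
      _ < ε := by linarith
  by_contra hbR
  have hcl : IsClosed (Y \ R) := by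
    -- The point `a` is inserted because chains have positive length, so `a` itself may fail to be
    -- in `R`.
    have : Y \ R = Y ∩ (⋃ y ∈ insert a R, Metric.ball (f y) ε)ᶜ := by
      ext z
      simp only [Set.mem_sdiff, mem_inter_iff, mem_compl_iff, mem_iUnion, Metric.mem_ball, not_exists]
      refine and_congr_right fun hz => ⟨fun hzR y hy hd => hzR ?_, fun hzU hzR => ?_⟩
      · rw [dist_comm] at hd
        rcases hy with rfl | hy
        · exact hone z hz hd
        · exact exists_chain_snoc hz hd hy
      · obtain ⟨m, hm, x, h0, h1, hx, hp⟩ := hzR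
        obtain ⟨k, rfl⟩ := Nat.exists_eq_succ_of_ne_zero hm.ne'
        have hk := hp k (by omega)
        rw [← Nat.succ_eq_add_one, h1, dist_comm] at hk
        refine hzU (x k) ?_ hk
        rcases Nat.eq_zero_or_pos k with rfl | hpos
        · exact Or.inl h0
        · exact Or.inr ⟨k, hpos, x, h0, rfl, fun n hn => hx n (by omega),
            fun n hn => hp n (by omega)⟩
    rw [this]
    exact hY.inter (isOpen_biUnion fun _ _ => Metric.isOpen_ball).isClosed_compl
  obtain ⟨z, hz, hzc⟩ := h (Y \ R) ⟨sdiff_subset, fun hsub' => (hsub' (hRY hz₀)).2 hz₀⟩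
    ⟨b, hb, hbR⟩ hcl
  obtain ⟨_, ⟨y, hy, rfl⟩, hyz⟩ := Metric.mem_closure_iff.1 hzc ε hε
  have hyR : y ∈ R := by
    by_contra hcon
    exact hy.2 ⟨hy.1, hcon⟩
  exact hz.2 (exists_chain_snoc hz.1 (by rwa [dist_comm]) hyR)

/-- If `M` and `closure (f '' (Y \ M))` were disjoint, they would be a positive distance apart, and
a sufficiently fine chain starting outside `M` could never enter it. -/
theorem InternallyChainTransitive.weaklyIncompressible (h : InternallyChainTransitive f Y)
    (hY : IsCompact Y) : WeaklyIncompressible f Y := by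
  intro M hM hne hMc
  by_contra hemp
  rw [not_nonempty_iff_eq_empty, ← disjoint_iff_inter_eq_empty] at hemp
  obtain ⟨ε, hε, hdis⟩ := hemp.exists_thickenings (hY.of_isClosed_subset hMc hM.1) isClosed_closure
  obtain ⟨a, haY, haM⟩ := exists_of_ssubset hM
  obtain ⟨b, hb⟩ := hne
  obtain ⟨m, -, x, h0, h1, hx, hp⟩ := h a haY b (hM.1 hb) ε hε
  have hnot : ∀ n ≤ m, x n ∉ M := by
    intro n
    induction n with
    | zero => intro _; rwa [h0]
    | succ n ih =>
      intro hn hxM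
      have hcl : f (x n) ∈ closure (f '' (Y \ M)) :=
        subset_closure (mem_image_of_mem f ⟨hx n (by omega), ih (by omega)⟩)
      exact disjoint_left.1 hdis (Metric.self_subset_thickening hε _ hxM)
        (Metric.mem_thickening_iff.2 ⟨_, hcl, by rw [dist_comm]; exact hp n (by omega)⟩)
  exact hnot m le_rfl (h1 ▸ hb)

theorem internallyChainTransitive_omegaLimitSet [CompactSpace X] (hf : Continuous f) (x : X) :
    InternallyChainTransitive f (omegaLimitSet f x) := by
  intro a ha b hb ε hε
  obtain ⟨δ', hδ', hu⟩ := Metric.uniformContinuous_iff.1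
    (CompactSpace.uniformContinuous_of_continuous hf) (ε / 2) (half_pos hε)
  set δ := min δ' (ε / 2)
  have hδ : 0 < δ := lt_min hδ' (half_pos hε)
  have hev : ∀ᶠ n : ℕ in atTop, ∃ y ∈ omegaLimitSet f x, dist (f^[n] x) y < δ := by
    have := eventually_mapsTo_of_isOpen_of_omegaLimit_subset (f := atTop)
      (ϕ := fun (n : ℕ) (y : X) => f^[n] y) (s := {x})
      (Metric.isOpen_thickening (δ := δ) (E := omegaLimitSet f x))
      (Metric.self_subset_thickening hδ _)
    filter_upwards [this] with n hn
    exact Metric.mem_thickening_iff.1 (hn (mem_singleton x))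
  obtain ⟨N, hN⟩ := eventually_atTop.1 hev
  have : Nonempty X := ⟨x⟩
  choose! y hyω hyd using hN
  obtain ⟨n₁, hn₁, hd₁⟩ := mem_omegaLimitSet_iff.1 ha δ hδ N
  -- Starting at `n₁ + 1` makes the chain nonempty even when `a = b`.
  obtain ⟨n₂, hn₂, hd₂⟩ := mem_omegaLimitSet_iff.1 hb δ hδ (n₁ + 1)
  have key : ∃ z : ℕ → X, z n₁ = a ∧ z n₂ = b ∧
      ∀ n ≥ N, z n ∈ omegaLimitSet f x ∧ dist (f^[n] x) (z n) < δ := by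
    refine ⟨Function.update (Function.update y n₁ a) n₂ b, ?_, by simp, ?_⟩
    · rw [Function.update_of_ne (by omega), Function.update_self]
    · intro n hn
      by_cases h2 : n = n₂
      · subst h2; simpa using ⟨hb, hd₂⟩
      by_cases h1 : n = n₁
      · subst h1; rw [Function.update_of_ne h2, Function.update_self]; exact ⟨ha, hd₁⟩
      · rw [Function.update_of_ne h2, Function.update_of_ne h1]; exact ⟨hyω n hn, hyd n hn⟩
  obtain ⟨z, hz₁, hz₂, hz⟩ := key
  refine ⟨n₂ - n₁, by omega, fun k => z (n₁ + k), hz₁, ?_, fun n _ => (hz _ (by omega)).1, ?_⟩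
  · dsimp only
    rw [Nat.add_sub_cancel' (by omega), hz₂]
  · intro n _
    have h1 := hu ((hz (n₁ + n) (by omega)).2.trans_le (min_le_left _ _))
    have h2 := (hz (n₁ + (n + 1)) (by omega)).2.trans_le (min_le_right _ _)
    rw [← add_assoc, Function.iterate_succ_apply', add_assoc] at h2
    calc dist (f (z (n₁ + n))) (z (n₁ + (n + 1)))
        ≤ dist (f (f^[n₁ + n] x)) (f (z (n₁ + n))) +
            dist (f (f^[n₁ + n] x)) (z (n₁ + (n + 1))) := dist_triangle_left _ _ _
      _ < ε := by linarith

/-- The successor of position `p.2` of block `p.1`, when block `k` has length `m k`. -/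
def blockStep (m : ℕ → ℕ) (p : ℕ × ℕ) : ℕ × ℕ :=
  if p.2 + 1 < m p.1 then (p.1, p.2 + 1) else (p.1 + 1, 0)

theorem blockStep_iterate_sum {m : ℕ → ℕ} (hm : ∀ k, 0 < m k) (k : ℕ) :
    (blockStep m)^[∑ i ∈ Finset.range k, m i] (0, 0) = (k, 0) := by
  have inner : ∀ k i, i < m k → (blockStep m)^[i] (k, 0) = (k, i) := by
    intro k i
    induction i with
    | zero => intro _; rfl
    | succ i ih =>
      intro hi
      rw [Function.iterate_succ_apply', ih (by omega), blockStep, if_pos hi]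
  induction k with
  | zero => rfl
  | succ k ih =>
    obtain ⟨j, hj⟩ := Nat.exists_eq_succ_of_ne_zero (hm k).ne'
    rw [Finset.sum_range_succ, add_comm, Function.iterate_add_apply, ih, hj,
      Function.iterate_succ_apply', inner k j (by omega), blockStep, if_neg (by simp [hj])]

/-- In an internally chain transitive set, any sequence of points is a subsequence of an
asymptotic pseudo-orbit. -/
theorem InternallyChainTransitive.exists_asymptotic_pseudoOrbit
    (h : InternallyChainTransitive f Y) {u : ℕ → X} (hu : ∀ k, u k ∈ Y) :
    ∃ x : ℕ → X, (∀ n, x n ∈ Y) ∧ Tendsto (fun n => dist (f (x n)) (x (n + 1))) atTop (𝓝 0) ∧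
      ∃ t : ℕ → ℕ, StrictMono t ∧ ∀ k, x (t k) = u k := by
  choose m hm c h0 h1 hc hp using fun k : ℕ =>
    h (u k) (hu k) (u (k + 1)) (hu (k + 1)) (1 / ((k : ℝ) + 1)) (by positivity)
  set st : ℕ → ℕ × ℕ := fun n => (blockStep m)^[n] (0, 0) with hst
  have hsucc : ∀ n, st (n + 1) = blockStep m (st n) := fun n =>
    Function.iterate_succ_apply' _ _ _
  have hlt : ∀ n, (st n).2 < m (st n).1 := by
    intro n
    induction n with
    | zero => exact hm 0
    | succ n ih =>
      rw [hsucc, blockStep]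
      split_ifs with hi
      · exact hi
      · exact hm _
  have hmono : Monotone fun n => (st n).1 := by
    refine monotone_nat_of_le_succ fun n => ?_
    simp only [hsucc, blockStep]
    split_ifs <;> simp
  set t : ℕ → ℕ := fun k => ∑ i ∈ Finset.range k, m i with ht
  have hstt : ∀ k, st (t k) = (k, 0) := blockStep_iterate_sum hm
  have htend : Tendsto (fun n => (st n).1) atTop atTop :=
    tendsto_atTop_atTop_of_monotone hmono fun k => ⟨t k, by rw [hstt]⟩
  refine ⟨fun n => c (st n).1 (st n).2, fun n => hc _ _ (hlt n).le, ?_, t, ?_, ?_⟩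
  · refine squeeze_zero (fun _ => dist_nonneg) (fun n => ?_)
      (tendsto_one_div_add_atTop_nhds_zero_nat.comp htend)
    have hd := hp (st n).1 (st n).2 (hlt n)
    refine le_trans (le_of_eq ?_) hd.le
    simp only [hsucc, blockStep]
    split_ifs with hi
    · rfl
    -- The final point of a block is never visited as such: it equals the initial point of the next
    -- block.
    · have : (st n).2 + 1 = m (st n).1 := by have := hlt n; omega
      rw [this, h1, h0]
  · exact strictMono_nat_of_lt_succ fun k => by simp [ht, Finset.sum_range_succ, hm k]
  · intro k
    simp only [hstt, h0]

/-- If asymptotic pseudo-orbits in `Y` are asymptotically shadowed, then a compact internally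
chain transitive set `Y` is an `ω`-limit set. -/
theorem InternallyChainTransitive.exists_eq_omegaLimitSet (h : InternallyChainTransitive f Y)
    (hY : IsCompact Y) (hne : Y.Nonempty)
    (hsh : ∀ x : ℕ → X, (∀ n, x n ∈ Y) →
      Tendsto (fun n => dist (f (x n)) (x (n + 1))) atTop (𝓝 0) →
      ∃ z N, Tendsto (fun n => dist (f^[n] z) (x (n + N))) atTop (𝓝 0)) :
    ∃ z, Y = omegaLimitSet f z := by
  have : CompactSpace Y := isCompact_iff_compactSpace.1 hY
  have : Nonempty Y := hne.to_subtype
  -- Taking the first component of `Nat.unpair` repeats every term of the dense sequence infinitely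
  -- often.
  obtain ⟨x, hxY, hxt, t, ht, hxu⟩ := h.exists_asymptotic_pseudoOrbit
    (u := fun k => (TopologicalSpace.denseSeq Y (Nat.unpair k).1 : X)) fun k => Subtype.coe_prop _
  obtain ⟨z, N, hz⟩ := hsh x hxY hxt
  have hev : ∀ ε > 0, ∀ᶠ n in atTop, dist (f^[n] z) (x (n + N)) < ε := fun ε hε =>
    hz.eventually_lt_const hε
  refine ⟨z, Subset.antisymm (fun y hy => mem_omegaLimitSet_iff.2 fun ε hε K => ?_)
    (fun y hy => ?_)⟩
  · obtain ⟨K', hK'⟩ := eventually_atTop.1 (hev (ε / 2) (half_pos hε))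
    obtain ⟨i, hi⟩ := (TopologicalSpace.denseRange_denseSeq Y).exists_dist_lt ⟨y, hy⟩ (half_pos hε)
    have hle := ht.id_le (Nat.pair i (K + K' + N))
    have hle' := Nat.right_le_pair i (K + K' + N)
    have hv := hxu (Nat.pair i (K + K' + N))
    set T := t (Nat.pair i (K + K' + N))
    simp only [id] at hle
    refine ⟨T - N, by omega, ?_⟩
    have h1 := hK' (T - N) (by omega)
    rw [Nat.sub_add_cancel (by omega), hv, Nat.unpair_pair] at h1
    rw [Subtype.dist_eq, dist_comm] at hi
    exact (dist_triangle _ _ _).trans_lt (by simpa using add_lt_add h1 hi)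
  · rw [← hY.isClosed.closure_eq, Metric.mem_closure_iff]
    intro ε hε
    obtain ⟨K', hK'⟩ := eventually_atTop.1 (hev (ε / 2) (half_pos hε))
    obtain ⟨n, hn, hd⟩ := mem_omegaLimitSet_iff.1 hy (ε / 2) (half_pos hε) K'
    refine ⟨_, hxY (n + N), (dist_triangle_left _ _ (f^[n] z)).trans_lt ?_⟩
    have := hK' n hn
    linarith

/-- The equivalence on a compact space, given asymptotic shadowing in closed internally chain
transitive sets. -/
theorem tfae_of_shadowing [CompactSpace X] (hf : Continuous f) (hY : IsClosed Y)
    (hne : Y.Nonempty) (hs : ∀ y, Y = {y} → f y = y)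
    (hsh : InternallyChainTransitive f Y → ∀ x : ℕ → X, (∀ n, x n ∈ Y) →
      Tendsto (fun n => dist (f (x n)) (x (n + 1))) atTop (𝓝 0) →
      ∃ z N, Tendsto (fun n => dist (f^[n] z) (x (n + N))) atTop (𝓝 0)) :
    List.TFAE [WeaklyIncompressible f Y, InternallyChainTransitive f Y,
      ∃ x : X, Y = omegaLimitSet f x] := by
  tfae_have 1 → 2 := fun h => h.internallyChainTransitive hf hY hs
  tfae_have 2 → 1 := fun h => h.weaklyIncompressible hY.isCompact
  tfae_have 2 → 3 := fun h => h.exists_eq_omegaLimitSet hY.isCompact hne (hsh h)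
  tfae_have 3 → 2 := by
    rintro ⟨x, rfl⟩
    exact internallyChainTransitive_omegaLimitSet hf x
  tfae_finish

end ChainTransitivity

/-! ### Shadowing from contracting preimages -/

section Pullback

variable {X : Type*} [MetricSpace X] {f : X → X} {κ : ℝ} {S T : Set X}

/-- Points close to `f x`, for `x ∈ S`, have preimages near `x`, with contraction factor `κ`. -/
def HasContractingPreimages (f : X → X) (κ : ℝ) (S : Set X) : Prop :=
  ∃ δ > 0, ∀ x ∈ S, ∀ z, dist z (f x) < δ → ∃ y, f y = z ∧ dist y x ≤ κ * dist z (f x)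

theorem HasContractingPreimages.mono (h : HasContractingPreimages f κ T) (hST : S ⊆ T) :
    HasContractingPreimages f κ S :=
  let ⟨δ, hδ, H⟩ := h
  ⟨δ, hδ, fun x hx => H x (hST hx)⟩

theorem HasContractingPreimages.union (hS : HasContractingPreimages f κ S)
    (hT : HasContractingPreimages f κ T) : HasContractingPreimages f κ (S ∪ T) := by
  obtain ⟨δ, hδ, H⟩ := hS
  obtain ⟨δ', hδ', H'⟩ := hT
  refine ⟨min δ δ', lt_min hδ hδ', fun x hx z hz => ?_⟩
  rcases hx with hx | hx
  · exact H x hx z (hz.trans_le (min_le_left _ _))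
  · exact H' x hx z (hz.trans_le (min_le_right _ _))

theorem IsCompact.hasContractingPreimages (hS : IsCompact S)
    (h : ∀ x ∈ S, ∃ t ∈ 𝓝 x, HasContractingPreimages f κ t) : HasContractingPreimages f κ S :=
  hS.induction_on ⟨1, one_pos, fun _ hx => hx.elim⟩ (fun _ _ hst ht => ht.mono hst)
    (fun _ _ hs ht => hs.union ht) fun x hx =>
      let ⟨t, ht, H⟩ := h x hx
      ⟨t, mem_nhdsWithin_of_mem_nhds ht, H⟩

theorem HasContractingPreimages.exists_shadow [CompactSpace X] (h : HasContractingPreimages f κ S)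
    (hf : Continuous f) (hκ : 0 ≤ κ) (hκ1 : κ < 1) {x : ℕ → X} (hx : ∀ n, x n ∈ S)
    (hxt : Tendsto (fun n => dist (f (x n)) (x (n + 1))) atTop (𝓝 0)) :
    ∃ z N, Tendsto (fun n => dist (f^[n] z) (x (n + N))) atTop (𝓝 0) := by
  obtain ⟨δ, hδ, H⟩ := h
  -- `C` is the sum of the geometric series `κ + κ² + ⋯` of pulled-back errors.
  obtain ⟨C, hC0, hC⟩ : ∃ C : ℝ, 0 ≤ C ∧ κ * (C + 1) = C := by
    have : 0 < 1 - κ := by linarith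
    exact ⟨κ / (1 - κ), by positivity, by field_simp; ring⟩
  have hε₀ : 0 < δ / (C + 2) := by positivity
  obtain ⟨N, hN⟩ := eventually_atTop.1 (hxt.eventually_le_const hε₀)
  -- Backward construction. Since `z` is chosen before `ε`, the error at time `n` is controlled by
  -- the later jumps alone; this is what makes the shadowing asymptotic after passing to the limit
  -- in `m`.
  have fin : ∀ m a, N ≤ a → ∃ z, ∀ n ≤ m, ∀ ε,
      (∀ j ≥ n + a, dist (f (x j)) (x (j + 1)) ≤ ε) → dist (f^[n] z) (x (n + a)) ≤ C * ε := by
    intro m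
    induction m with
    | zero =>
      intro a _
      refine ⟨x a, fun n hn ε hε => ?_⟩
      obtain rfl : n = 0 := by omega
      have : 0 ≤ ε := dist_nonneg.trans (hε _ le_rfl)
      simpa using mul_nonneg hC0 this
    | succ m ih =>
      intro a ha
      obtain ⟨z₁, hz₁⟩ := ih (a + 1) (by omega)
      have step : ∀ ε, (∀ j ≥ a, dist (f (x j)) (x (j + 1)) ≤ ε) →
          dist z₁ (f (x a)) ≤ (C + 1) * ε := by
        intro ε hε
        have h1 := hz₁ 0 (by omega) ε fun j hj => hε j (by omega)
        rw [zero_add, Function.iterate_zero_apply] at h1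
        have h2 := dist_triangle_right z₁ (f (x a)) (x (a + 1))
        linarith [hε a le_rfl]
      obtain ⟨z, hz, hzd⟩ := H (x a) (hx a) z₁ <| by
        refine (step _ fun j hj => hN j (by omega)).trans_lt ?_
        rw [← mul_div_assoc, div_lt_iff₀ (by positivity)]
        nlinarith
      refine ⟨z, fun n hn ε hε => ?_⟩
      cases n with
      | zero =>
        rw [zero_add, Function.iterate_zero_apply]
        calc dist z (x a) ≤ κ * dist z₁ (f (x a)) := hzd
          _ ≤ κ * ((C + 1) * ε) := by
            gcongr
            exact step ε fun j hj => hε j (by omega)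
          _ = C * ε := by rw [← mul_assoc, hC]
      | succ n =>
        rw [Function.iterate_succ_apply, hz, show n + 1 + a = n + (a + 1) by omega]
        exact hz₁ n (by omega) ε fun j hj => hε j (by omega)
  choose w hw using fun m => fin m N le_rfl
  obtain ⟨z, φ, hφ, hlim⟩ := CompactSpace.tendsto_subseq w
  refine ⟨z, N, ?_⟩
  have bound : ∀ n ε, (∀ j ≥ n + N, dist (f (x j)) (x (j + 1)) ≤ ε) →
      dist (f^[n] z) (x (n + N)) ≤ C * ε := by
    intro n ε hε
    refine le_of_tendsto ((((hf.iterate n).tendsto z).comp hlim).dist tendsto_const_nhds) ?_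
    filter_upwards [hφ.tendsto_atTop.eventually_ge_atTop n] with k hk
    exact hw _ n hk ε hε
  rw [Metric.tendsto_atTop]
  intro ε hε
  obtain ⟨K, hK⟩ := eventually_atTop.1
    (hxt.eventually_le_const (show 0 < ε / (C + 1) by positivity))
  refine ⟨K, fun n hn => ?_⟩
  rw [Real.dist_0_eq_abs, abs_of_nonneg dist_nonneg]
  refine (bound n _ fun j hj => hK j (by omega)).trans_lt ?_
  rw [← mul_div_assoc, div_lt_iff₀ (by positivity)]
  nlinarith

end Pullback

/-! ### Expanding piecewise linear interval maps -/

section Interval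

variable {f : I → I} {x₀ : I} {e s s' r r' μ : ℝ}

/-- On the side `e = ±1` of `x₀`, up to distance `r`, the map `f` is affine with gradient `e * s`. -/
def SlopeOnSide (f : I → I) (x₀ : I) (e s r : ℝ) : Prop :=
  0 < r ∧ 0 ≤ x₀ + e * r ∧ x₀ + e * r ≤ 1 ∧
    ∀ y : I, 0 ≤ e * (y - x₀) → e * (y - x₀) ≤ r → (f y : ℝ) - f x₀ = s * (e * (y - x₀))

/-- Every point has, on each side of it that lies in `I`, a neighbourhood on which `f` is affine
with gradient modulus at least `μ`. -/
def LocallyExpanding (f : I → I) (μ : ℝ) : Prop :=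
  ∀ (x₀ : I) (e : ℝ), (e = 1 ∨ e = -1) → (∃ y : I, 0 < e * (y - x₀)) →
    ∃ s r, μ ≤ |s| ∧ SlopeOnSide f x₀ e s r

theorem UniformlyPiecewiseLinear.expandingPiecewiseLinear (h : UniformlyPiecewiseLinear f) :
    ExpandingPiecewiseLinear f :=
  let ⟨m, c, a, _, hp, hs, ha⟩ := h
  ⟨m, c, a, hp, fun i => (ha i).symm ▸ hs⟩

theorem PiecewiseLinearWith.continuous {m : ℕ} {c : Fin (m + 1) → I} {a : Fin m → ℝ}
    (h : PiecewiseLinearWith f m c a) : Continuous f := by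
  obtain ⟨h0, h1, hc, ha⟩ := h
  have hcov : ⋃ i : Fin m, Icc (c i.castSucc) (c i.succ) = univ := by
    refine eq_univ_of_forall fun x => ?_
    by_contra hcon
    simp only [mem_iUnion, mem_Icc, not_exists, not_and, not_le] at hcon
    have : ∀ j, c j ≤ x := by
      intro j
      induction j using Fin.induction with
      | zero => rw [h0]; exact x.2.1
      | succ i ih => exact (hcon i ih).le
    obtain ⟨k, rfl⟩ : ∃ k, m = k + 1 := Nat.exists_eq_succ_of_ne_zero <| by
      rintro rfl
      exact zero_ne_one (h0.symm.trans h1)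
    have hlt := hcon (Fin.last k) (this _)
    rw [Fin.succ_last, h1] at hlt
    exact hlt.not_ge x.2.2
  refine (locallyFinite_of_finite _).continuous hcov (fun i => isClosed_Icc) fun i => ?_
  rw [Topology.IsInducing.subtypeVal.continuousOn_iff]
  have hcont : Continuous fun y : I =>
      a i * ((y : ℝ) - (c i.castSucc : ℝ)) + (f (c i.castSucc) : ℝ) := by fun_prop
  refine hcont.continuousOn.congr fun y hy => ?_
  have := ha i (c i.castSucc) ⟨le_rfl, (hc i.castSucc_lt_succ).le⟩ y hy
  simp only [Function.comp_apply]
  linarith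

theorem ExpandingPiecewiseLinear.continuous (h : ExpandingPiecewiseLinear f) : Continuous f :=
  let ⟨_, _, _, hp, _⟩ := h
  hp.continuous

theorem ExpandingPiecewiseLinear.exists_locallyExpanding (h : ExpandingPiecewiseLinear f) :
    ∃ μ > 1, LocallyExpanding f μ := by
  obtain ⟨m, c, a, ⟨h0, h1, hc, ha⟩, hexp⟩ := h
  obtain ⟨k, rfl⟩ : ∃ k, m = k + 1 := Nat.exists_eq_succ_of_ne_zero <| by
    rintro rfl
    exact zero_ne_one (h0.symm.trans h1)
  obtain ⟨i₀, hi₀⟩ := Finite.exists_min fun i => |a i|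
  refine ⟨|a i₀|, hexp i₀, ?_⟩
  rintro x₀ e (rfl | rfl) ⟨y₀, hy₀⟩
  · obtain ⟨i, hi, hi'⟩ : ∃ i : Fin (k + 1), c i.castSucc ≤ x₀ ∧ x₀ < c i.succ := by
      by_contra! hcon
      have : ∀ j, c j ≤ x₀ := by
        intro j
        induction j using Fin.induction with
        | zero => rw [h0]; exact x₀.2.1
        | succ i ih => exact hcon i ih
      have := this (Fin.last _)
      rw [h1] at this
      have h2 : (1 : ℝ) ≤ x₀ := this
      linarith [y₀.2.2]
    refine ⟨a i, c i.succ - x₀, hi₀ i, sub_pos.2 hi', ?_, ?_, fun y hy hy' => ?_⟩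
    · linarith [(c i.succ).2.1]
    · linarith [(c i.succ).2.2]
    · have hxy : x₀ ≤ y := Subtype.coe_le_coe.1 (by linarith)
      have hyc : y ≤ c i.succ := Subtype.coe_le_coe.1 (by linarith)
      rw [one_mul]
      exact ha i x₀ ⟨hi, hi'.le⟩ y ⟨hi.trans hxy, hyc⟩
  · obtain ⟨i, hi, hi'⟩ : ∃ i : Fin (k + 1), c i.castSucc < x₀ ∧ x₀ ≤ c i.succ := by
      by_contra! hcon
      have : ∀ j, c j < x₀ := by
        intro j
        induction j using Fin.induction with
        | zero =>
          rw [h0]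
          refine Subtype.coe_lt_coe.1 ?_
          have := y₀.2.1
          simp only [Icc.coe_zero]
          linarith
        | succ i ih => exact hcon i ih
      have := this (Fin.last _)
      rw [h1] at this
      exact this.not_ge x₀.2.2
    -- The slope is measured in the direction away from `x₀`, hence the sign on the left.
    refine ⟨-a i, x₀ - c i.castSucc, by simpa using hi₀ i, sub_pos.2 hi, ?_, ?_,
      fun y hy hy' => ?_⟩
    · linarith [(c i.castSucc).2.1]
    · linarith [(c i.castSucc).2.2]
    · have hxy : y ≤ x₀ := Subtype.coe_le_coe.1 (by linarith)
      have hyc : c i.castSucc ≤ y := Subtype.coe_le_coe.1 (by linarith)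
      rw [ha i x₀ ⟨hi.le, hi'⟩ y ⟨hyc, hxy.trans hi'⟩]
      ring

/-- If `s * (f y - f x₀) ≥ 0` for all `y` near `x₀`, then `f` has a local extremum at `x₀`. -/
theorem isLocalExtr_of_forall_abs_sub_lt (hr : 0 < r)
    (h : ∀ y : I, |(y : ℝ) - x₀| < r → 0 ≤ s * ((f y : ℝ) - f x₀)) (hs : s ≠ 0) :
    IsLocalExtr f x₀ := by
  have hev : ∀ᶠ y : I in 𝓝 x₀, 0 ≤ s * ((f y : ℝ) - f x₀) := by
    filter_upwards [Metric.ball_mem_nhds x₀ hr] with y hy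
    exact h y hy
  rcases hs.lt_or_gt with hs | hs
  · right
    filter_upwards [hev] with y hy
    exact Subtype.coe_le_coe.1 (by nlinarith)
  · left
    filter_upwards [hev] with y hy
    exact Subtype.coe_le_coe.1 (by nlinarith)

theorem SlopeOnSide.isLocalExtr_of_forall (h : SlopeOnSide f x₀ e s r) (he : e = 1 ∨ e = -1)
    (hs : s ≠ 0) (hall : ∀ y : I, 0 ≤ e * (y - x₀)) : IsLocalExtr f x₀ := by
  refine isLocalExtr_of_forall_abs_sub_lt h.1 (s := s) (fun y hy => ?_) hs
  rw [h.2.2.2 y (hall y) ?_, ← mul_assoc]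
  · exact mul_nonneg (mul_self_nonneg s) (hall y)
  · have := abs_lt.1 hy
    rcases he with rfl | rfl <;> linarith

theorem SlopeOnSide.isLocalExtr (h : SlopeOnSide f x₀ e s r) (h' : SlopeOnSide f x₀ (-e) s' r')
    (he : e = 1 ∨ e = -1) (hs : s ≠ 0) (hss : 0 ≤ s * s') : IsLocalExtr f x₀ := by
  refine isLocalExtr_of_forall_abs_sub_lt (lt_min h.1 h'.1) (s := s) (fun y hy => ?_) hs
  have hy1 := abs_lt.1 (hy.trans_le (min_le_left _ _))
  have hy2 := abs_lt.1 (hy.trans_le (min_le_right _ _))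
  rcases le_total 0 (e * ((y : ℝ) - x₀)) with hpos | hneg
  · rw [h.2.2.2 y hpos ?_, ← mul_assoc]
    · exact mul_nonneg (mul_self_nonneg s) hpos
    · rcases he with rfl | rfl <;> linarith
  · have hneg' : 0 ≤ -e * ((y : ℝ) - x₀) := by linarith
    rw [h'.2.2.2 y hneg' ?_, ← mul_assoc]
    · exact mul_nonneg hss hneg'
    · rcases he with rfl | rfl <;> linarith

theorem SlopeOnSide.exists_apply_eq (h : SlopeOnSide f x₀ e s r) (he : e = 1 ∨ e = -1)
    (hs : 1 < |s|) {z : I} (hz : 0 ≤ s * ((z : ℝ) - f x₀)) (hzr : |(z : ℝ) - f x₀| ≤ r) :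
    ∃ y : I, f y = z ∧ 0 ≤ e * ((y : ℝ) - x₀) ∧ e * ((y : ℝ) - x₀) ≤ r := by
  have hs0 : s ≠ 0 := by rintro rfl; norm_num at hs
  set t := ((z : ℝ) - f x₀) / s with ht
  have hst : s * t = (z : ℝ) - f x₀ := mul_div_cancel₀ _ hs0
  have ht0 : 0 ≤ t := by
    rw [← hst, ← mul_assoc] at hz
    exact nonneg_of_mul_nonneg_right hz (mul_self_pos.2 hs0)
  have htr : t ≤ r := by
    rw [← hst, abs_mul, abs_of_nonneg ht0] at hzr
    nlinarith
  have hee : e * e = 1 := by rcases he with rfl | rfl <;> norm_num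
  have hmem : (x₀ : ℝ) + e * t ∈ Icc (0 : ℝ) 1 := by
    obtain ⟨h0, h1, h2, -⟩ := h
    have := x₀.2.1
    have := x₀.2.2
    rcases he with rfl | rfl <;> constructor <;> linarith
  have hdiff : e * (((⟨_, hmem⟩ : I) : ℝ) - x₀) = t := by
    simp only [add_sub_cancel_left, ← mul_assoc, hee, one_mul]
  refine ⟨⟨_, hmem⟩, ?_, hdiff.ge.trans' ht0, hdiff.le.trans htr⟩
  have := h.2.2.2 ⟨_, hmem⟩ (hdiff.ge.trans' ht0) (hdiff.le.trans htr)
  rw [hdiff, hst] at this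
  exact Subtype.ext (by linarith)

theorem SlopeOnSide.abs_sub_le (h : SlopeOnSide f x₀ e s r) (he : e = 1 ∨ e = -1) (hs : μ ≤ |s|)
    {x y : I} (hx0 : 0 ≤ e * ((x : ℝ) - x₀)) (hxr : e * ((x : ℝ) - x₀) ≤ r)
    (hy0 : 0 ≤ e * ((y : ℝ) - x₀)) (hyr : e * ((y : ℝ) - x₀) ≤ r) :
    μ * |(y : ℝ) - x| ≤ |(f y : ℝ) - f x| := by
  have hx := h.2.2.2 x hx0 hxr
  have hy := h.2.2.2 y hy0 hyr
  have : (f y : ℝ) - f x = s * (e * ((y : ℝ) - x)) := by linear_combination hy - hx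
  have he' : |e| = 1 := by rcases he with rfl | rfl <;> norm_num
  rw [this, abs_mul, abs_mul, he', one_mul]
  gcongr

/-- An endpoint of `I` with nonzero slope is a local extremum, as is a point whose two outward
slopes have the same sign. Otherwise both sides exist and their outward slopes have opposite signs.
-/
theorem LocallyExpanding.exists_opposite (h : LocallyExpanding f μ) (he : e = 1 ∨ e = -1)
    (hs : s ≠ 0) (hside : SlopeOnSide f x₀ e s r) (hext : ¬ IsLocalExtr f x₀) :
    ∃ s' r', μ ≤ |s'| ∧ SlopeOnSide f x₀ (-e) s' r' ∧ s * s' < 0 := by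
  by_cases hy : ∃ y : I, 0 < -e * ((y : ℝ) - x₀)
  · obtain ⟨s', r', hs', h'⟩ := h x₀ (-e) (by rcases he with rfl | rfl <;> simp) hy
    exact ⟨s', r', hs', h', not_le.1 fun hss => hext (hside.isLocalExtr h' he hs hss)⟩
  · push Not at hy
    exact absurd (hside.isLocalExtr_of_forall he hs fun y => by linarith [hy y]) hext

/-- A target `z` on the same side of `f x₀` as `f x` is reached on the affine piece of `x`; one
beyond `f x₀` is reached across `x₀`. At an extremum with value `0` or `1` the second case does not
arise. -/
theorem SlopeOnSide.hasContractingPreimages (hside : SlopeOnSide f x₀ e s r)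
    (h : LocallyExpanding f μ) (hf : Continuous f) (hμ : 1 < μ) (he : e = 1 ∨ e = -1)
    (hs : μ ≤ |s|) (hext : IsLocalExtr f x₀ → f x₀ = 0 ∨ f x₀ = 1) :
    ∃ t ∈ 𝓝 x₀, HasContractingPreimages f μ⁻¹ (t ∩ {x : I | 0 ≤ e * ((x : ℝ) - x₀)}) := by
  have hs0 : s ≠ 0 := by rintro rfl; norm_num at hs; linarith
  have habs : ∀ x y : I, μ * |(y : ℝ) - x| ≤ |(f y : ℝ) - f x| →
      dist y x ≤ μ⁻¹ * dist (f y) (f x) := fun x y hxy => by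
    rw [Subtype.dist_eq, Subtype.dist_eq, Real.dist_eq, Real.dist_eq, inv_mul_eq_div,
      le_div_iff₀ (by linarith), mul_comm]
    exact hxy
  have hnear : ∀ ρ > 0, ∀ᶠ x in 𝓝 x₀, |(f x : ℝ) - f x₀| < ρ := fun ρ hρ =>
    hf.continuousAt.eventually (Metric.ball_mem_nhds (f x₀) hρ)
  have hnear' : ∀ ρ > 0, ∀ᶠ x : I in 𝓝 x₀, |(x : ℝ) - x₀| < ρ := fun ρ hρ =>
    Metric.ball_mem_nhds x₀ hρ
  have hle : ∀ x : I, e * ((x : ℝ) - x₀) ≤ |(x : ℝ) - x₀| := fun x => by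
    rcases he with rfl | rfl
    · linarith [le_abs_self ((x : ℝ) - x₀)]
    · linarith [neg_abs_le ((x : ℝ) - x₀)]
  have hzx : ∀ {ρ : ℝ} {x z : I}, |(f x : ℝ) - f x₀| < ρ / 2 → dist z (f x) < ρ / 2 →
      |(z : ℝ) - f x₀| ≤ ρ := fun {ρ x z} h1 h2 => by
    rw [Subtype.dist_eq, Real.dist_eq] at h2
    linarith [_root_.abs_sub_le (z : ℝ) (f x) (f x₀)]
  have same : ∀ x : I, 0 ≤ e * ((x : ℝ) - x₀) → |(x : ℝ) - x₀| < r →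
      |(f x : ℝ) - f x₀| < r / 2 → ∀ z : I, dist z (f x) < r / 2 →
      0 ≤ s * ((z : ℝ) - f x₀) → ∃ y, f y = z ∧ dist y x ≤ μ⁻¹ * dist z (f x) := by
    intro x hx0 hxr hfx z hz hsz
    obtain ⟨y, rfl, hy0, hyr⟩ :=
      hside.exists_apply_eq he (hμ.trans_le hs) hsz (hzx hfx hz)
    exact ⟨y, rfl, habs _ _ (hside.abs_sub_le he hs hx0 ((hle x).trans hxr.le) hy0 hyr)⟩
  by_cases hx₀ : IsLocalExtr f x₀
  -- As `f` stays in `[0,1]`, its outward slope at an extreme value points into the interval,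
  -- towards every `z`.
  · have hsign : ∀ z : I, 0 ≤ s * ((z : ℝ) - f x₀) := by
      intro z
      obtain ⟨hr, h0, h1, hsl⟩ := hside
      have hee : e * e = 1 := by rcases he with rfl | rfl <;> norm_num
      have hdiff : e * (((⟨_, h0, h1⟩ : I) : ℝ) - x₀) = r := by
        simp only [add_sub_cancel_left, ← mul_assoc, hee, one_mul]
      have hv := hsl ⟨_, h0, h1⟩ (hdiff.ge.trans' hr.le) hdiff.le
      rw [hdiff] at hv
      rcases hext hx₀ with h' | h' <;> rw [h'] at hv ⊢
      · have hpos : 0 ≤ s := by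
          have := (f ⟨_, h0, h1⟩).2.1
          simp only [Icc.coe_zero] at hv
          by_contra! hneg
          nlinarith
        simpa using mul_nonneg hpos z.2.1
      · have hneg : s ≤ 0 := by
          have := (f ⟨_, h0, h1⟩).2.2
          simp only [Icc.coe_one] at hv
          by_contra! hpos
          nlinarith
        exact mul_nonneg_of_nonpos_of_nonpos hneg (sub_nonpos.2 z.2.2)
    refine ⟨_, (hnear' r hside.1).and (hnear (r / 2) (half_pos hside.1)), r / 2,
      half_pos hside.1, ?_⟩
    rintro x ⟨⟨hx1, hx2⟩, hx0⟩ z hz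
    exact same x hx0 hx1 hx2 z hz (hsign z)
  · obtain ⟨s', r', hs', hside', hss⟩ := h.exists_opposite he hs0 hside hx₀
    have he' : -e = 1 ∨ -e = -1 := by rcases he with rfl | rfl <;> simp
    have hρ : 0 < min (r / 2) (r' / 2) := lt_min (half_pos hside.1) (half_pos hside'.1)
    refine ⟨_, (hnear' r hside.1).and (hnear _ hρ), _, hρ, ?_⟩
    rintro x ⟨⟨hx1, hx2⟩, hx0⟩ z hz
    by_cases hsz : 0 ≤ s * ((z : ℝ) - f x₀)
    · exact same x hx0 hx1 (hx2.trans_le (min_le_left _ _)) z (hz.trans_le (min_le_left _ _)) hsz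
    push Not at hsz
    have hsz' : 0 ≤ s' * ((z : ℝ) - f x₀) := by
      have := mul_pos_of_neg_of_neg hss hsz
      have hpos : 0 < s * s * (s' * ((z : ℝ) - f x₀)) := by linarith
      exact (pos_of_mul_pos_right hpos (mul_self_nonneg s)).le
    obtain ⟨y, rfl, hy0, hyr⟩ := hside'.exists_apply_eq he' (hμ.trans_le hs') hsz'
      (hzx (hx2.trans_le (min_le_right _ _)) (hz.trans_le (min_le_right _ _)))
    refine ⟨y, rfl, habs _ _ ?_⟩
    have hxr := (hle x).trans hx1.le
    have hx : μ * |(x : ℝ) - x₀| ≤ |(f x : ℝ) - f x₀| := hside.abs_sub_le (x := x₀) he hs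
      (by simp) (by simpa using hside.1.le) hx0 hxr
    have hy : μ * |(y : ℝ) - x₀| ≤ |(f y : ℝ) - f x₀| := hside'.abs_sub_le (x := x₀) he' hs'
      (by simp) (by simpa using hside'.1.le) hy0 hyr
    have hprod : ((f y : ℝ) - f x₀) * ((f x : ℝ) - f x₀) ≤ 0 := by
      rw [hside.2.2.2 x hx0 hxr, ← mul_assoc, mul_comm _ s]
      exact mul_nonpos_of_nonpos_of_nonneg hsz.le hx0
    -- Since `f x₀` lies between `f x` and `f y`, the expansion estimates on the two sides add up
    -- with no loss.
    have hadd : |(f y : ℝ) - f x| = |(f y : ℝ) - f x₀| + |(f x : ℝ) - f x₀| := by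
      rcases mul_nonpos_iff.1 hprod with ⟨h1, h2⟩ | ⟨h1, h2⟩
      · rw [abs_of_nonneg h1, abs_of_nonpos h2, abs_of_nonneg (by linarith)]; ring
      · rw [abs_of_nonpos h1, abs_of_nonneg h2, abs_of_nonpos (by linarith)]; ring
    have htri : |(y : ℝ) - x| ≤ |(y : ℝ) - x₀| + |(x : ℝ) - x₀| := by
      rw [abs_sub_comm (x : ℝ)]
      exact _root_.abs_sub_le _ _ _
    rw [hadd]
    nlinarith

theorem LocallyExpanding.exists_mem_nhds_hasContractingPreimages (h : LocallyExpanding f μ)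
    (hf : Continuous f) (hμ : 1 < μ) (hext : IsLocalExtr f x₀ → f x₀ = 0 ∨ f x₀ = 1) :
    ∃ t ∈ 𝓝 x₀, HasContractingPreimages f μ⁻¹ t := by
  have key : ∀ e : ℝ, (e = 1 ∨ e = -1) → (∃ y : I, 0 < e * ((y : ℝ) - x₀)) →
      ∃ t ∈ 𝓝 x₀, HasContractingPreimages f μ⁻¹ (t ∩ {x : I | 0 ≤ e * ((x : ℝ) - x₀)}) := by
    intro e he hy
    obtain ⟨s, r, hs, hside⟩ := h x₀ e he hy
    exact hside.hasContractingPreimages h hf hμ he hs hext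
  by_cases h0 : ∃ y : I, 0 < (-1 : ℝ) * ((y : ℝ) - x₀)
  · obtain ⟨t, ht, H⟩ := key (-1) (Or.inr rfl) h0
    by_cases h1 : ∃ y : I, 0 < (1 : ℝ) * ((y : ℝ) - x₀)
    · obtain ⟨t', ht', H'⟩ := key 1 (Or.inl rfl) h1
      refine ⟨t ∩ t', inter_mem ht ht', (H.union H').mono fun x hx => ?_⟩
      rcases le_total x x₀ with hle | hle
      · exact Or.inl ⟨hx.1, by simpa using hle⟩
      · exact Or.inr ⟨hx.2, by simpa using hle⟩
    · push Not at h1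
      exact ⟨t, ht, H.mono fun x hx => ⟨hx, by rw [mem_ofPred_eq]; linarith [h1 x]⟩⟩
  · push Not at h0
    obtain ⟨t, ht, H⟩ := key 1 (Or.inl rfl) ⟨1, by have := h0 0; simp only [Icc.coe_zero, Icc.coe_one] at this ⊢; linarith⟩
    exact ⟨t, ht, H.mono fun x hx => ⟨hx, by rw [mem_ofPred_eq]; linarith [h0 x]⟩⟩

theorem ExpandingPiecewiseLinear.tfae (h : ExpandingPiecewiseLinear f) {Y : Set I}
    (hY : IsClosed Y) (hne : Y.Nonempty) (hs : ∀ y, Y = {y} → f y = y)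
    (hext : InternallyChainTransitive f Y → ∀ x ∈ Y, IsLocalExtr f x → f x = 0 ∨ f x = 1) :
    List.TFAE [WeaklyIncompressible f Y, InternallyChainTransitive f Y,
      ∃ x : I, Y = omegaLimitSet f x] := by
  obtain ⟨μ, hμ, hexp⟩ := h.exists_locallyExpanding
  refine tfae_of_shadowing h.continuous hY hne hs fun hict x hx hxt => ?_
  exact (hY.isCompact.hasContractingPreimages fun x₀ hx₀ =>
    hexp.exists_mem_nhds_hasContractingPreimages h.continuous hμ (hext hict x₀ hx₀)).exists_shadow
      h.continuous (by positivity) (inv_lt_one_of_one_lt₀ hμ) hx hxt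

/-- If `Y` is strongly invariant and contains no image of a critical point, then endpoints of the
interval that lie in `Y` are mapped to endpoints. -/
theorem apply_eq_zero_or_one_of_isLocalExtr {Y : Set I} (hmaps : MapsTo f Y Y)
    (hsurj : SurjOn f Y Y) (hcrit : ∀ c, IsCriticalPoint f c → f c ∉ Y) {x : I} (hx : x ∈ Y)
    (hext : IsLocalExtr f x) : f x = 0 ∨ f x = 1 := by
  have hend : ∀ x ∈ Y, IsLocalExtr f x → x = 0 ∨ x = 1 := by
    intro x hx hext
    by_contra! hcon
    exact hcrit x ⟨unitInterval.pos_iff_ne_zero.2 hcon.1, unitInterval.lt_one_iff_ne_one.2 hcon.2,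
      hext⟩ (hmaps hx)
  -- A point mapped to `0` or `1` is an extremum of `f`, so in `Y` it must be an endpoint. Going
  -- back twice, `v ↦ w ↦ x` stays among two endpoints, so `x` is fixed or lies on a 2-cycle.
  have hpre : ∀ b ∈ Y, b = 0 ∨ b = 1 → ∃ w ∈ Y, f w = b ∧ (w = 0 ∨ w = 1) := by
    intro b hb hb01
    obtain ⟨w, hw, rfl⟩ := hsurj hb
    refine ⟨w, hw, rfl, hend w hw ?_⟩
    rcases hb01 with h | h
    · exact Or.inl (Eventually.of_forall fun y => h ▸ (f y).2.1)
    · exact Or.inr (Eventually.of_forall fun y => h ▸ (f y).2.2)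
  obtain ⟨w, hw, hwx, hw01⟩ := hpre x hx (hend x hx hext)
  by_cases hwx' : w = x
  · subst hwx'
    rwa [hwx]
  obtain ⟨v, hv, hvw, hv01⟩ := hpre w hw hw01
  by_cases hvx : v = x
  · subst hvx
    rwa [hvw]
  have hvw' : v = w := by
    rcases hend x hx hext with h1 | h1 <;> rcases hw01 with h2 | h2 <;>
      rcases hv01 with h3 | h3 <;> simp_all
  rw [hvw', hwx] at hvw
  exact absurd hvw.symm hwx'

end Interval

/-! ### Shift maps -/

section ShiftMaps

variable {A : Type*}

theorem oneSidedShiftMap_iterate_apply {F : Set (List A)} (x : OneSidedShift F) (n i : ℕ) :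
    ((oneSidedShiftMap F)^[n] x).1 i = x.1 (i + n) := by
  induction n generalizing x with
  | zero => rfl
  | succ n ih =>
    rw [Function.iterate_succ_apply, ih]
    exact congrArg x.1 (by omega)

theorem twoSidedShiftMap_iterate_apply {F : Set (List A)} (x : TwoSidedShift F) (n : ℕ) (i : ℤ) :
    ((twoSidedShiftMap F)^[n] x).1 i = x.1 (i + n) := by
  induction n generalizing x with
  | zero => simp
  | succ n ih =>
    rw [Function.iterate_succ_apply, ih]
    exact congrArg x.1 (by push_cast; omega)

theorem exists_length_le_of_finite {F : Set (List A)} (hF : F.Finite) :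
    ∃ L : ℕ, ∀ w ∈ F, w.length ≤ L := by
  obtain ⟨L, hL⟩ := (hF.image List.length).bddAbove
  exact ⟨L, fun w hw => hL (mem_image_of_mem _ hw)⟩

theorem continuous_oneSidedShiftMap [TopologicalSpace A] (F : Set (List A)) : Continuous (oneSidedShiftMap F) := by
  refine Topology.IsInducing.subtypeVal.continuous_iff.2 (continuous_pi fun n => ?_)
  exact (continuous_apply (n + 1)).comp continuous_subtype_val

theorem continuous_twoSidedShiftMap [TopologicalSpace A] (F : Set (List A)) : Continuous (twoSidedShiftMap F) := by
  refine Topology.IsInducing.subtypeVal.continuous_iff.2 (continuous_pi fun n => ?_)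
  exact (continuous_apply (n + 1)).comp continuous_subtype_val

end ShiftMaps

/-! ### Metrics on symbolic spaces -/

section SymbolicSpaces

variable {X : Type*} [MetricSpace X] {A : Type*} [TopologicalSpace A] [DiscreteTopology A]
  {J : Type*}

theorem isClosed_setOf_forall_ne_window {n : ℕ} (g : Fin n → J) (w : Fin n → A) :
    IsClosed {x : J → A | ¬ ∀ j, x (g j) = w j} := by
  rw [← isOpen_compl_iff]
  have : {x : J → A | ¬ ∀ j, x (g j) = w j}ᶜ = ⋂ j, (fun x : J → A => x (g j)) ⁻¹' {w j} := by
    ext x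
    simp
  rw [this]
  exact isOpen_iInter_of_finite fun j => (isOpen_discrete _).preimage (continuous_apply (g j))

theorem isClosed_oneSidedShift (F : Set (List A)) : IsClosed (OneSidedShift F) := by
  simp only [OneSidedShift, ofPred_forall]
  refine isClosed_iInter fun w => isClosed_iInter fun _ => isClosed_iInter fun i => ?_
  convert isClosed_setOf_forall_ne_window (fun j : Fin w.length => i + (j : ℕ))
    (fun j => w[j]) using 4
  exact ⟨fun h j => h j j.2, fun h j hj => h ⟨j, hj⟩⟩

theorem isClosed_twoSidedShift (F : Set (List A)) : IsClosed (TwoSidedShift F) := by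
  simp only [TwoSidedShift, ofPred_forall]
  refine isClosed_iInter fun w => isClosed_iInter fun _ => isClosed_iInter fun i => ?_
  convert isClosed_setOf_forall_ne_window (fun j : Fin w.length => i + ((j : ℕ) : ℤ))
    (fun j => w[j]) using 4
  exact ⟨fun h j => h j j.2, fun h j hj => h ⟨j, hj⟩⟩

variable {S : Set (J → A)}

/-- By compactness both sequences converge along any ultrafilter, here to a common limit, near which
each coordinate is constant. No particular metric is needed. -/
theorem eventually_apply_eq_of_tendsto_dist [CompactSpace X] (h : X ≃ₜ S) {a b : ℕ → X}
    (hab : Tendsto (fun n => dist (a n) (b n)) atTop (𝓝 0)) (i : J) :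
    ∀ᶠ n in atTop, (h (a n)).1 i = (h (b n)).1 i := by
  rw [Filter.Eventually, mem_iff_ultrafilter]
  intro U hU
  have lim : ∀ a : ℕ → X, ∃ p, Tendsto a U (𝓝 p) := fun a =>
    ⟨_, Ultrafilter.le_nhds_lim (U.map a)⟩
  obtain ⟨p, hp⟩ := lim a
  obtain ⟨q, hq⟩ := lim b
  obtain rfl : p = q := dist_eq_zero.1 (tendsto_nhds_unique (hp.dist hq) (hab.mono_left hU))
  have hcoord : Tendsto (fun x : X => (h x).1 i) (𝓝 p) (pure ((h p).1 i)) := by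
    rw [← nhds_discrete]
    exact ((continuous_apply i).comp (continuous_subtype_val.comp h.continuous)).tendsto p
  filter_upwards [tendsto_pure.1 (hcoord.comp hp), tendsto_pure.1 (hcoord.comp hq)] with n h1 h2
  exact h1.trans h2.symm

theorem tendsto_dist_of_eventually_apply_eq [CompactSpace X] (h : X ≃ₜ S) {a b : ℕ → X}
    (hab : ∀ i, ∀ᶠ n in atTop, (h (a n)).1 i = (h (b n)).1 i) :
    Tendsto (fun n => dist (a n) (b n)) atTop (𝓝 0) := by
  rw [tendsto_iff_ultrafilter]
  intro U hU
  have lim : ∀ a : ℕ → X, ∃ p, Tendsto a U (𝓝 p) := fun a =>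
    ⟨_, Ultrafilter.le_nhds_lim (U.map a)⟩
  obtain ⟨p, hp⟩ := lim a
  obtain ⟨q, hq⟩ := lim b
  have hcoord : ∀ i, Continuous fun x : X => (h x).1 i := fun i =>
    (continuous_apply i).comp (continuous_subtype_val.comp h.continuous)
  have hpq : p = q := by
    refine h.injective (Subtype.ext (funext fun i => ?_))
    exact tendsto_nhds_unique_of_eventuallyEq (((hcoord i).tendsto p).comp hp)
      (((hcoord i).tendsto q).comp hq) (hU (hab i))
  simpa [hpq] using hp.dist hq

end SymbolicSpaces

/-! ### Shadowing in shifts of finite type -/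

section ShiftShadowing

variable {X : Type*} [MetricSpace X] {f : X → X} {A : Type*} [TopologicalSpace A]
  [DiscreteTopology A] {F : Set (List A)}

theorem oneSidedShift_exists_shadow [CompactSpace X] (hF : F.Finite) (h : X ≃ₜ OneSidedShift F)
    (hsc : Function.Semiconj h f (oneSidedShiftMap F)) {x : ℕ → X}
    (hxt : Tendsto (fun n => dist (f (x n)) (x (n + 1))) atTop (𝓝 0)) :
    ∃ z N, Tendsto (fun n => dist (f^[n] z) (x (n + N))) atTop (𝓝 0) := by
  obtain ⟨L, hL⟩ := exists_length_le_of_finite hF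
  set p : ℕ → ℕ → A := fun n => (h (x n)).1 with hp
  have step : ∀ i, ∀ᶠ n in atTop, p n (i + 1) = p (n + 1) i := fun i => by
    filter_upwards [eventually_apply_eq_of_tendsto_dist h hxt i] with n hn
    rw [hsc] at hn
    exact hn
  have steps : ∀ j i, ∀ᶠ n in atTop, p n (i + j) = p (n + j) i := by
    intro j
    induction j with
    | zero => intro i; simp
    | succ j ih =>
      intro i
      filter_upwards [ih (i + 1), (tendsto_add_atTop_nat j).eventually (step i)] with n h1 h2
      rw [show i + (j + 1) = i + 1 + j by omega, h1, h2, add_assoc]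
  -- Forbidden words have length at most `L`, so agreement at finitely many offsets suffices and one
  -- `N` serves them all.
  obtain ⟨N, hN⟩ := eventually_atTop.1
    ((finite_lt_nat L).eventually_all.2 fun j _ => steps j 0)
  simp only [mem_ofPred_eq, zero_add] at hN
  have hz : (fun j => p (N + j) 0) ∈ OneSidedShift F := by
    intro w hw i hwin
    refine (h (x (N + i))).2 w hw 0 fun j hj => ?_
    rw [← hwin j hj, zero_add]
    exact (hN (N + i) (by omega) j (hj.trans_le (hL w hw))).trans (by rw [add_assoc])
  refine ⟨h.symm ⟨_, hz⟩, N, tendsto_dist_of_eventually_apply_eq h fun i => ?_⟩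
  filter_upwards [(tendsto_add_atTop_nat N).eventually (steps i 0)] with n hn
  rw [hsc.iterate_right n, h.apply_symm_apply, oneSidedShiftMap_iterate_apply]
  rw [zero_add] at hn
  exact (congrArg (fun k => p k 0) (by omega)).trans hn.symm

theorem twoSidedShift_exists_shadow [CompactSpace X] (hF : F.Finite) (h : X ≃ₜ TwoSidedShift F)
    (hsc : Function.Semiconj h f (twoSidedShiftMap F)) {x : ℕ → X}
    (hxt : Tendsto (fun n => dist (f (x n)) (x (n + 1))) atTop (𝓝 0)) :
    ∃ z N, Tendsto (fun n => dist (f^[n] z) (x (n + N))) atTop (𝓝 0) := by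
  obtain ⟨L, hL⟩ := exists_length_le_of_finite hF
  set p : ℕ → ℤ → A := fun n => (h (x n)).1 with hp
  have step : ∀ i, ∀ᶠ n in atTop, p n (i + 1) = p (n + 1) i := fun i => by
    filter_upwards [eventually_apply_eq_of_tendsto_dist h hxt i] with n hn
    rw [hsc] at hn
    exact hn
  have steps : ∀ (j : ℕ) i, ∀ᶠ n in atTop, p n (i + j) = p (n + j) i := by
    intro j
    induction j with
    | zero => intro i; simp
    | succ j ih =>
      intro i
      filter_upwards [ih (i + 1), (tendsto_add_atTop_nat j).eventually (step i)] with n h1 h2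
      rw [show i + ((j + 1 : ℕ) : ℤ) = i + 1 + j by push_cast; omega, h1, h2, add_assoc]
  obtain ⟨N, hN⟩ := eventually_atTop.1
    ((finite_lt_nat L).eventually_all.2 fun j _ => steps j 0)
  simp only [mem_ofPred_eq, zero_add] at hN
  -- The past is copied from the single point `x N`. A window starting at a negative index reaches
  -- fewer than `L` places past `0`, where `p N` still agrees with `y`.
  set y : ℤ → A := fun j => if j < 0 then p N j else p (N + j.toNat) 0 with hy
  have hz : y ∈ TwoSidedShift F := by
    intro w hw i hwin
    rcases lt_or_ge i 0 with hi | hi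
    · refine (h (x N)).2 w hw i fun j hj => ?_
      rw [← hwin j hj]
      simp only [hy]
      split_ifs with hij
      · rfl
      · have := hN N le_rfl (i + j).toNat (by have := hL w hw; omega)
        rwa [Int.toNat_of_nonneg (not_lt.1 hij)] at this
    · refine (h (x (N + i.toNat))).2 w hw 0 fun j hj => ?_
      rw [← hwin j hj, zero_add]
      simp only [hy]
      rw [if_neg (by omega)]
      refine (hN (N + i.toNat) (by omega) j (hj.trans_le (hL w hw))).trans ?_
      exact congrArg (fun k => p k 0) (by omega)
  refine ⟨h.symm ⟨y, hz⟩, N, tendsto_dist_of_eventually_apply_eq h fun i => ?_⟩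
  -- For negative `i` the relation `steps` is read backwards, from the earlier time `n + i`.
  have hcoord : ∀ᶠ n : ℕ in atTop, ∀ k : ℕ, (k : ℤ) = n + i → p n i = p k 0 := by
    rcases le_total 0 i with hi | hi
    · lift i to ℕ using hi
      filter_upwards [steps i 0] with n hn k hk
      rw [zero_add] at hn
      rw [hn, show k = n + i by omega]
    · obtain ⟨j, rfl⟩ : ∃ j : ℕ, i = -j := ⟨i.natAbs, by omega⟩
      filter_upwards [(tendsto_sub_atTop_nat j).eventually (steps j (-j)),
        eventually_ge_atTop j] with n hn hjn k hk
      rw [neg_add_cancel, Nat.sub_add_cancel hjn] at hn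
      rw [← hn, show k = n - j by omega]
  filter_upwards [(tendsto_add_atTop_nat N).eventually hcoord,
    eventually_ge_atTop (-i).toNat] with n hn hin
  rw [hsc.iterate_right n, h.apply_symm_apply, twoSidedShiftMap_iterate_apply]
  simp only [hy]
  rw [if_neg (by omega)]
  exact (hn _ (by push_cast; omega)).symm

theorem Homeomorph.continuous_of_semiconj {Z : Type*} [TopologicalSpace Z] {g : Z → Z} (h : X ≃ₜ Z)
    (hsc : Function.Semiconj h f g) (hg : Continuous g) : Continuous f := by
  rw [← h.comp_continuous_iff, hsc.comp_eq]
  exact hg.comp h.continuous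

end ShiftShadowing

/-! ### The equivalence in the interval and shift cases -/

theorem mainTheorem3 :
    -- uniformly piecewise linear maps with value `0` or `1` at every local extremum
    (∀ f : I → I, UniformlyPiecewiseLinear f →
      (∀ x : I, IsLocalExtr f x → f x = 0 ∨ f x = 1) →
      ∀ Λ : Set I, IsClosed Λ →
      ∀ Y : Set I, Y ⊆ Λ → IsClosed Y → Y.Nonempty → (∀ y, Y = {y} → f y = y) →
        List.TFAE [WeaklyIncompressible f Y, InternallyChainTransitive f Y,
          ∃ x : I, Y = omegaLimitSet f x]) ∧
    -- expanding piecewise linear maps, `Λ` containing no image of a critical point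
    (∀ f : I → I, ExpandingPiecewiseLinear f →
      ∀ Λ : Set I, IsClosed Λ → (∀ c : I, IsCriticalPoint f c → f c ∉ Λ) →
      ∀ Y : Set I, Y ⊆ Λ → IsClosed Y → Y.Nonempty → (∀ y, Y = {y} → f y = y) →
        List.TFAE [WeaklyIncompressible f Y, InternallyChainTransitive f Y,
          ∃ x : I, Y = omegaLimitSet f x]) ∧
    -- one-sided shifts of finite type, with any metric inducing the product topology
    (∀ (X : Type*) [MetricSpace X] (f : X → X)
      (A : Type*) [Finite A] [TopologicalSpace A] [DiscreteTopology A]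
      (F : Set (List A)), F.Finite →
      ∀ h : X ≃ₜ OneSidedShift F, Function.Semiconj h f (oneSidedShiftMap F) →
      ∀ Λ : Set X, IsClosed Λ →
      ∀ Y : Set X, Y ⊆ Λ → IsClosed Y → Y.Nonempty → (∀ y, Y = {y} → f y = y) →
        List.TFAE [WeaklyIncompressible f Y, InternallyChainTransitive f Y,
          ∃ x : X, Y = omegaLimitSet f x]) ∧
    -- two-sided shifts of finite type, with any metric inducing the product topology
    (∀ (X : Type*) [MetricSpace X] (f : X → X)
      (A : Type*) [Finite A] [TopologicalSpace A] [DiscreteTopology A]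
      (F : Set (List A)), F.Finite →
      ∀ h : X ≃ₜ TwoSidedShift F, Function.Semiconj h f (twoSidedShiftMap F) →
      ∀ Λ : Set X, IsClosed Λ →
      ∀ Y : Set X, Y ⊆ Λ → IsClosed Y → Y.Nonempty → (∀ y, Y = {y} → f y = y) →
        List.TFAE [WeaklyIncompressible f Y, InternallyChainTransitive f Y,
          ∃ x : X, Y = omegaLimitSet f x]) := by
  refine ⟨?_, ?_, ?_, ?_⟩
  · intro f hf hext _ _ Y _ hY hne hs
    exact hf.expandingPiecewiseLinear.tfae hY hne hs fun _ x _ hx => hext x hx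
  · intro f hf Λ _ hcrit Y hYΛ hY hne hs
    -- Chain transitivity gives `f '' Y = Y`, which excludes interior extrema from `Y` and lets
    -- endpoints be traced backwards.
    exact hf.tfae hY hne hs fun hict _ hx hext =>
      apply_eq_zero_or_one_of_isLocalExtr (hict.mapsTo hY)
        (hict.surjOn hf.continuous hY.isCompact) (fun c hc hcY => hcrit c hc (hYΛ hcY)) hx hext
  · intro X _ f A _ _ _ F hF h hsc _ _ Y _ hY hne hs
    have : CompactSpace (OneSidedShift F) :=
      isCompact_iff_compactSpace.1 (isClosed_oneSidedShift F).isCompact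
    have : CompactSpace X := h.symm.compactSpace
    exact tfae_of_shadowing (h.continuous_of_semiconj hsc (continuous_oneSidedShiftMap F)) hY hne hs
      fun _ _ _ hxt => oneSidedShift_exists_shadow hF h hsc hxt
  · intro X _ f A _ _ _ F hF h hsc _ _ Y _ hY hne hs
    have : CompactSpace (TwoSidedShift F) :=
      isCompact_iff_compactSpace.1 (isClosed_twoSidedShift F).isCompact
    have : CompactSpace X := h.symm.compactSpace
    exact tfae_of_shadowing (h.continuous_of_semiconj hsc (continuous_twoSidedShiftMap F)) hY hne hs
      fun _ _ _ hxt => twoSidedShift_exists_shadow hF h hsc hxt
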